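/- Conventions: manifolds are smooth ($C^\infty$), finite-dimensional, Hausdorff and without boundary; Lie groups are moreover second countable; a submersion is a surjective smooth map whose differential is surjective at every point. Let $M$ be a manifold of dimension $n$. An *s-space* over $M$ is a collection $\lambda=(N,\psi,O,R,\{e_i\}_{i=1}^n)$ where $N$ is a manifold; $\psi:N\to M$ is a submersion; $O$ is a Lie group; $R:N\times O\to N$, $R(z,a)=R_a(z)=z.a$, is a smooth right action with $\psi\circ R_a=\psi$ for all $a\in O$ which is transitive on each fibre of $\psi$; and $e_1,\dots,e_n:N\to TM$ are smooth maps such that $\{e_1(z),\dots,e_n(z)\}$ is a basis of the tangent space $T_{\psi(z)}M$ for every $z\in N$. **Theorem.** Let $\lambda=(N,\psi,O,R,\{e_i\})$ be an s-space over $M$ such that $O$ acts without fixed points, i.e. if $z.a=z$ for some $z\in N$ and $a\in O$, then $a=e$. Then $(N,\psi,O,R)$ is a principal fibre bundle over $M$. That is, $R$ is a free smooth right action; $\psi$ is a smooth map which is a topological quotient map and whose fibres are exactly the orbits of $O$; and every $p\in M$ has an open neighbourhood $U$ together with a diffeomorphism $\tau=(\psi,\phi):\psi^{-1}(U)\to U\times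 O$ such that $\phi(z.a)=\phi(z)\,a$ for all $z\in\psi^{-1}(U)$ and $a\in O$. Moreover, the orbit space $N/O$ with the quotient topology carries a smooth $n$-dimensional manifold structure for which the projection $\pi:N\to N/O$ is a submersion and the map $N/O\to M$, $[z]\mapsto\psi(z)$, is a well-defined diffeomorphism. -/

import Mathlib

open scoped Manifold ContDiff

/-- `f` is a (surjective) smooth submersion: it is smooth, onto, and its differential is onto at
every point. -/
structure IsSmoothSubmersion {m n : ℕ}
    {N : Type*} [TopologicalSpace N] [ChartedSpace (EuclideanSpace ℝ (Fin m)) N]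
    {M : Type*} [TopologicalSpace M] [ChartedSpace (EuclideanSpace ℝ (Fin n)) M]
    (f : N → M) : Prop where
  contMDiff : ContMDiff (𝓡 m) (𝓡 n) ∞ f
  surjective : Function.Surjective f
  surjective_mfderiv : ∀ z : N, Function.Surjective (mfderiv (𝓡 m) (𝓡 n) f z)

/-- An s-space `(N, ψ, O, R, {e_i})` over the `n`-dimensional manifold `M`, where `N` is an
`m`-dimensional manifold and `O` a `k`-dimensional Lie group. -/
structure SSpace (n m k : ℕ)
    (M : Type*) [TopologicalSpace M] [ChartedSpace (EuclideanSpace ℝ (Fin n)) M]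
    [IsManifold (𝓡 n) ∞ M]
    (N : Type*) [TopologicalSpace N] [ChartedSpace (EuclideanSpace ℝ (Fin m)) N]
    [IsManifold (𝓡 m) ∞ N]
    (O : Type*) [TopologicalSpace O] [ChartedSpace (EuclideanSpace ℝ (Fin k)) O]
    [Group O] [LieGroup (𝓡 k) ∞ O] where
  /-- The projection `ψ : N → M`. -/
  proj : N → M
  isSmoothSubmersion_proj : IsSmoothSubmersion (m := m) (n := n) proj
  /-- The right action `R`; `act z a` is `z.a`. -/
  act : N → O → N
  act_one : ∀ z : N, act z 1 = z
  act_mul : ∀ (z : N) (a b : O), act z (a * b) = act (act z a) b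
  contMDiff_act : ContMDiff ((𝓡 m).prod (𝓡 k)) (𝓡 m) ∞ (fun p : N × O => act p.1 p.2)
  /-- The action preserves the fibres of `ψ`. -/
  proj_act : ∀ (z : N) (a : O), proj (act z a) = proj z
  /-- The action is transitive on each fibre of `ψ`. -/
  transitive : ∀ z w : N, proj z = proj w → ∃ a : O, act z a = w
  /-- The maps `e_i : N → TM`, with `e_i(z)` tangent to `M` at `ψ(z)`. -/
  frame : Fin n → (z : N) → TangentSpace (𝓡 n) (proj z)
  contMDiff_frame : ∀ i : Fin n, ContMDiff (𝓡 m) (𝓡 n).tangent ∞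
    (fun z : N => (⟨proj z, frame i z⟩ : TangentBundle (𝓡 n) M))
  /-- `{e_1(z), …, e_n(z)}` is a basis of the tangent space of `M` at `ψ(z)`. -/
  linearIndependent_frame : ∀ z : N, LinearIndependent ℝ (fun i => frame i z)
  span_frame : ∀ z : N, Submodule.span ℝ (Set.range fun i => frame i z) = ⊤

/-- The orbit equivalence relation on `N`: `z ∼ w` if and only if `w = z.a` for some `a ∈ O`. The
quotient by it, with the quotient topology, is the orbit space `N/O`. -/
def SSpace.orbitSetoid {n m k : ℕ}
    {M : Type*} [TopologicalSpace M] [ChartedSpace (EuclideanSpace ℝ (Fin n)) M]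
    [IsManifold (𝓡 n) ∞ M]
    {N : Type*} [TopologicalSpace N] [ChartedSpace (EuclideanSpace ℝ (Fin m)) N]
    [IsManifold (𝓡 m) ∞ N]
    {O : Type*} [TopologicalSpace O] [ChartedSpace (EuclideanSpace ℝ (Fin k)) O]
    [Group O] [LieGroup (𝓡 k) ∞ O]
    (S : SSpace n m k M N O) : Setoid N where
  r z w := ∃ a : O, S.act z a = w
  iseqv :=
    { refl := fun z => ⟨1, S.act_one z⟩
      symm := by
        rintro z w ⟨a, rfl⟩
        exact ⟨a⁻¹, by rw [← S.act_mul, mul_inv_cancel, S.act_one]⟩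
      trans := by
        rintro x y z ⟨a, rfl⟩ ⟨b, rfl⟩
        exact ⟨a * b, S.act_mul x a b⟩ }

/-- `(N, ψ, O, R)` is a (smooth) principal fibre bundle over `M` with structure group `O`. -/
structure IsPrincipalFiberBundle (n m k : ℕ)
    {M : Type*} [TopologicalSpace M] [ChartedSpace (EuclideanSpace ℝ (Fin n)) M]
    {N : Type*} [TopologicalSpace N] [ChartedSpace (EuclideanSpace ℝ (Fin m)) N]
    {O : Type*} [TopologicalSpace O] [ChartedSpace (EuclideanSpace ℝ (Fin k)) O] [Group O]
    (ψ : N → M) (R : N → O → N) : Prop where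
  /-- `R` is a smooth right action. -/
  act_one : ∀ z : N, R z 1 = z
  act_mul : ∀ (z : N) (a b : O), R z (a * b) = R (R z a) b
  contMDiff_act : ContMDiff ((𝓡 m).prod (𝓡 k)) (𝓡 m) ∞ (fun p : N × O => R p.1 p.2)
  /-- The action is free. -/
  free : ∀ (z : N) (a : O), R z a = z → a = 1
  /-- `ψ` is smooth and exhibits `M` as the quotient space `N/O`: it is a topological quotient map
  (in particular surjective) whose fibres are exactly the orbits. -/
  contMDiff_proj : ContMDiff (𝓡 m) (𝓡 n) ∞ ψ
  isQuotientMap_proj : Topology.IsQuotientMap ψ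
  proj_eq_iff : ∀ z w : N, ψ z = ψ w ↔ ∃ a : O, R z a = w
  /-- Local triviality: every `p ∈ M` has an open neighbourhood `U` and a diffeomorphism
  `τ = (ψ, φ) : ψ⁻¹(U) → U × O` with `φ(z.a) = φ(z) a`. -/
  locallyTrivial : ∀ p : M, ∃ U : Set M, IsOpen U ∧ p ∈ U ∧
    ∃ τ : PartialDiffeomorph (𝓡 m) ((𝓡 n).prod (𝓡 k)) N (M × O) ∞,
      τ.source = ψ ⁻¹' U ∧ τ.target = U ×ˢ Set.univ ∧
      (∀ z : N, ψ z ∈ U → (τ.toPartialEquiv z).1 = ψ z) ∧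
      (∀ (z : N) (a : O), ψ z ∈ U →
        (τ.toPartialEquiv (R z a)).2 = (τ.toPartialEquiv z).2 * a)

/-! A local section `g` of `ψ` over an open set `t` gives a smooth map `(x, a) ↦ g(x).a` from `t ×
O` to `ψ⁻¹(t)`, bijective by transitivity and freeness. Local triviality says that its inverse is
smooth.

By equivariance it suffices to treat points of the section, where `a = 1`. There the differential is
injective: applying `dψ` kills the horizontal part, and orbit maps are immersive because a kernel
vector would generate a curve in `O` on which the injective orbit map is constant
(`injective_mfderiv_one_of_equivariant`). It is then surjective once `m ≤ n + k` (`dim_le`). Here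
second countability of `O` enters: the map covers an open subset of `N` from a Lindelöf source, and
C¹ maps do not raise Hausdorff dimension. A local section of the bijection is its inverse, hence the
inverse is smooth.

Local sections also make `ψ` open, so `N/O` is homeomorphic to `M` and inherits its manifold
structure. -/

/-! ### Local sections of submersions -/

open Topology in
theorem ContDiffOn.exists_local_section {E F : Type*} [NormedAddCommGroup E] [NormedSpace ℝ E]
    [NormedAddCommGroup F] [NormedSpace ℝ F] [FiniteDimensional ℝ F]
    {f : E → F} {s : Set E} (hf : ContDiffOn ℝ ∞ f s) (hs : IsOpen s) {x : E} (hx : x ∈ s)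
    (hsurj : Function.Surjective (fderiv ℝ f x)) :
    ∃ (g : F → E) (t : Set F), IsOpen t ∧ f x ∈ t ∧ ContDiffOn ℝ ∞ g t ∧ g (f x) = x ∧
      Set.MapsTo g t s ∧ ∀ y ∈ t, f (g y) = y := by
  have := FiniteDimensional.complete ℝ F
  obtain ⟨R₀, hR₀⟩ := (fderiv ℝ f x).toLinearMap.exists_rightInverse_of_surjective
    (LinearMap.range_eq_top.2 hsurj)
  let R : F →L[ℝ] E := LinearMap.toContinuousLinearMap R₀
  have hR (v : F) : fderiv ℝ f x (R v) = v := LinearMap.congr_fun hR₀ v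
  -- An affine slice through `x` along a linear right inverse of the differential: `f ∘ i` has
  -- derivative the identity at `f x`, so the inverse function theorem applies and the section is `i
  -- ∘ (f ∘ i)⁻¹`.
  let i : F → E := fun y ↦ x + R (y - f x)
  have hi : ContDiff ℝ ∞ i := by fun_prop
  have hix : i (f x) = x := by simp [i]
  have hi' : HasFDerivAt i R (f x) := by
    have h1 : HasFDerivAt (fun y ↦ y - f x) (ContinuousLinearMap.id ℝ F) (f x) :=
      (hasFDerivAt_id (f x)).sub_const (f x)
    exact (R.hasFDerivAt.comp (f x) h1).const_add x
  let h : F → F := f ∘ i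
  have hv : IsOpen (i ⁻¹' s) := hs.preimage hi.continuous
  have hh : ContDiffOn ℝ ∞ h (i ⁻¹' s) := hf.comp hi.contDiffOn (fun _ h ↦ h)
  have hxv : f x ∈ i ⁻¹' s := by simpa [hix] using hx
  have hhx : ContDiffAt ℝ ∞ h (f x) := hh.contDiffAt (hv.mem_nhds hxv)
  have hhfx : h (f x) = f x := by simp [h, hix]
  have hd : HasFDerivAt h ((ContinuousLinearEquiv.refl ℝ F : F ≃L[ℝ] F) : F →L[ℝ] F) (f x) := by
    have h1 : HasFDerivAt f (fderiv ℝ f x) (i (f x)) := by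
      rw [hix]
      exact ((hf.contDiffAt (hs.mem_nhds hx)).differentiableAt (by simp)).hasFDerivAt
    convert h1.comp (f x) hi' using 1
    ext v
    simp [hR]
  let e := hhx.toOpenPartialHomeomorph h hd (by simp)
  have he : (e : F → F) = h := rfl
  have hxe : f x ∈ e.source := hhx.mem_toOpenPartialHomeomorph_source hd (by simp)
  -- near `f x`, the derivative of `h` is invertible
  have hinv : ∀ᶠ y in 𝓝 (f x), ∃ L : F ≃L[ℝ] F, HasFDerivAt h (L : F →L[ℝ] F) y := by
    have hc : ContinuousAt (fderiv ℝ h) (f x) := (hhx.fderiv_right (m := 0) (by simp)).continuousAt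
    have hmem : Set.range ((↑) : (F ≃L[ℝ] F) → F →L[ℝ] F) ∈ 𝓝 (fderiv ℝ h (f x)) :=
      ContinuousLinearEquiv.isOpen.mem_nhds ⟨_, hd.fderiv.symm⟩
    filter_upwards [hc hmem, hv.mem_nhds hxv] with y ⟨L, hL⟩ hy
    refine ⟨L, ?_⟩
    rw [hL]
    exact ((hh.contDiffAt (hv.mem_nhds hy)).differentiableAt (by simp)).hasFDerivAt
  obtain ⟨w, hw, hwo, hxw⟩ := eventually_nhds_iff.1 (hinv.and (hv.mem_nhds hxv))
  have hsymm : e.symm (f x) = f x := by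
    conv_lhs => rw [← hhfx, ← he, e.left_inv hxe]
  have hxt : f x ∈ e.target := by
    have := e.map_source hxe
    rwa [he, hhfx] at this
  -- The inverse `e.symm` is smooth at each point whose image has invertible derivative, hence the
  -- restriction to the preimage of `w`.
  refine ⟨i ∘ e.symm, e.target ∩ e.symm ⁻¹' w, e.isOpen_inter_preimage_symm hwo,
    ⟨hxt, by simpa [hsymm] using hxw⟩, ?_, ?_, ?_, ?_⟩
  · intro y ⟨hyt, hyw⟩
    obtain ⟨⟨L, hL⟩, hyv⟩ := hw _ hyw
    exact (hi.contDiffAt.comp y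
      (e.contDiffAt_symm hyt hL (hh.contDiffAt (hv.mem_nhds hyv)))).contDiffWithinAt
  · simp [hsymm, hix]
  · intro y ⟨hyt, hyw⟩
    exact (hw _ hyw).2
  · intro y ⟨hyt, hyw⟩
    exact e.right_inv hyt

section

variable {E F H G A B : Type*} [NormedAddCommGroup E] [NormedSpace ℝ E]
  [NormedAddCommGroup F] [NormedSpace ℝ F] [FiniteDimensional ℝ F]
  [TopologicalSpace H] [TopologicalSpace G]
  {I : ModelWithCorners ℝ E H} {J : ModelWithCorners ℝ F G} [I.Boundaryless]
  [TopologicalSpace A] [ChartedSpace H A] [IsManifold I ∞ A]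
  [TopologicalSpace B] [ChartedSpace G B] [IsManifold J ∞ B]

/-- A map that is smooth on an open set has a smooth local section through every point of that set
at which its differential is onto. -/
theorem ContMDiffOn.exists_local_section {f : A → B} {s : Set A} (hs : IsOpen s)
    (hf : ContMDiffOn I J ∞ f s) {x : A} (hx : x ∈ s)
    (hsurj : Function.Surjective (mfderiv I J f x)) :
    ∃ (g : B → A) (t : Set B), IsOpen t ∧ f x ∈ t ∧ ContMDiffOn J I ∞ g t ∧ g (f x) = x ∧
      Set.MapsTo g t s ∧ ∀ y ∈ t, f (g y) = y := by
  let c := extChartAt I x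
  let d := extChartAt J (f x)
  let s' : Set A := s ∩ (chartAt H x).source ∩ f ⁻¹' (chartAt G (f x)).source
  have hs'o : IsOpen s' := (hf.continuousOn.mono Set.inter_subset_left).isOpen_inter_preimage
    (hs.inter (chartAt H x).open_source) (chartAt G (f x)).open_source
  have hxs' : x ∈ s' := ⟨⟨hx, by simp⟩, by simp⟩
  let u : Set E := c.target ∩ c.symm ⁻¹' s'
  have hu : IsOpen u := (continuousOn_extChartAt_symm x).isOpen_inter_preimage
    (isOpen_extChartAt_target x) hs'o
  have hcx : c x ∈ u := ⟨mem_extChartAt_target x, by simpa [c] using hxs'⟩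
  have hsm : ContDiffOn ℝ ∞ (d ∘ f ∘ c.symm) u := by
    rw [← contMDiffOn_iff_contDiffOn]
    refine (contMDiffOn_extChartAt (n := ∞) (x := f x)).comp
      (hf.comp ((contMDiffOn_extChartAt_symm x).mono Set.inter_subset_left) ?_) ?_
    · exact fun y hy ↦ hy.2.1.1
    · exact fun y hy ↦ by simpa using hy.2.2
  have hdx : MDifferentiableAt I J f x :=
    (hf.contMDiffAt (hs.mem_nhds hx)).mdifferentiableAt (by simp)
  have hfd : fderiv ℝ (d ∘ f ∘ c.symm) (c x) = mfderiv I J f x := by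
    rw [hdx.mfderiv, I.range_eq_univ, fderivWithin_univ]
    rfl
  obtain ⟨g, t, ht, hxt, hg, hgx, hgm, hgs⟩ := hsm.exists_local_section hu hcx
    (by rw [hfd]; exact hsurj)
  have hval : (d ∘ f ∘ c.symm) (c x) = d (f x) := by simp [c]
  rw [hval] at hxt hgx
  have htB : IsOpen (d.source ∩ d ⁻¹' t) :=
    (continuousOn_extChartAt (f x)).isOpen_inter_preimage (isOpen_extChartAt_source (f x)) ht
  refine ⟨c.symm ∘ g ∘ d, d.source ∩ d ⁻¹' t, htB, ⟨mem_extChartAt_source (f x), hxt⟩,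
    ?_, ?_, ?_, ?_⟩
  · refine (contMDiffOn_extChartAt_symm x).comp ((contMDiffOn_iff_contDiffOn.2 hg).comp
      ((contMDiffOn_extChartAt (n := ∞) (x := f x)).mono ?_) ?_) ?_
    · exact fun y hy ↦ by simpa [d] using hy.1
    · exact fun y hy ↦ hy.2
    · exact fun y hy ↦ (hgm hy.2).1
  · simp [hgx, c]
  · exact fun y hy ↦ (hgm hy.2).2.1.1
  · intro y hy
    have h1 := hgs _ hy.2
    have h2 : f (c.symm (g (d y))) ∈ d.source := by
      simpa [d] using (hgm hy.2).2.2
    exact d.injOn h2 hy.1 h1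

end

/-! ### Dimension bound from Hausdorff dimension -/

open Topology in
/-- A `C¹` map from a Lindelöf open set cannot cover an open subset of a manifold of larger
dimension. -/
theorem ContMDiffOn.finrank_le_of_image_mem_nhds {E F H G A B : Type*}
    [NormedAddCommGroup E] [NormedSpace ℝ E] [FiniteDimensional ℝ E]
    [NormedAddCommGroup F] [NormedSpace ℝ F] [FiniteDimensional ℝ F]
    [TopologicalSpace H] [TopologicalSpace G]
    {I : ModelWithCorners ℝ E H} {J : ModelWithCorners ℝ F G} [I.Boundaryless] [J.Boundaryless]
    [TopologicalSpace A] [ChartedSpace H A] [IsManifold I 1 A]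
    [TopologicalSpace B] [ChartedSpace G B] [IsManifold J 1 B]
    {f : A → B} {s : Set A} (hs : IsOpen s) (hL : IsLindelof s)
    (hf : ContMDiffOn I J 1 f s) {y : B} (hy : f '' s ∈ 𝓝 y) :
    Module.finrank ℝ F ≤ Module.finrank ℝ E := by
  let d := extChartAt J y
  have key : ∀ x ∈ s,
      dimH (d '' (f '' (s ∩ (chartAt H x).source) ∩ d.source)) ≤ Module.finrank ℝ E := by
    intro x hx
    let c := extChartAt I x
    let s' : Set A := s ∩ (chartAt H x).source ∩ f ⁻¹' (chartAt G y).source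
    have hs'o : IsOpen s' := (hf.continuousOn.mono Set.inter_subset_left).isOpen_inter_preimage
      (hs.inter (chartAt H x).open_source) (chartAt G y).open_source
    let u : Set E := c.target ∩ c.symm ⁻¹' s'
    have hu : IsOpen u := (continuousOn_extChartAt_symm x).isOpen_inter_preimage
      (isOpen_extChartAt_target x) hs'o
    have hsm : ContDiffOn ℝ 1 (d ∘ f ∘ c.symm) u := by
      rw [← contMDiffOn_iff_contDiffOn]
      refine (contMDiffOn_extChartAt (n := 1) (x := y)).comp
        (hf.comp ((contMDiffOn_extChartAt_symm x).mono Set.inter_subset_left) ?_) ?_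
      · exact fun y hy ↦ hy.2.1.1
      · exact fun y hy ↦ by simpa using hy.2.2
    have hsub : d '' (f '' (s ∩ (chartAt H x).source) ∩ d.source) ⊆ (d ∘ f ∘ c.symm) '' u := by
      rintro _ ⟨_, ⟨⟨a, ha, rfl⟩, hfa⟩, rfl⟩
      have hac : a ∈ c.source := by simpa [c] using ha.2
      refine ⟨c a, ⟨c.map_source hac, ?_⟩, by simp [c.left_inv hac]⟩
      simp only [Set.mem_preimage, c.left_inv hac]
      exact ⟨ha, by simpa [d] using hfa⟩
    calc _ ≤ dimH ((d ∘ f ∘ c.symm) '' u) := dimH_mono hsub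
      _ ≤ dimH u := dimH_image_le_of_locally_lipschitzOn fun p hp ↦ by
          obtain ⟨K, t, ht, hKt⟩ := ((hsm.contDiffAt (hu.mem_nhds hp)).hasStrictFDerivAt
            (by simp)).exists_lipschitzOnWith
          exact ⟨K, t, mem_nhdsWithin_of_mem_nhds ht, hKt⟩
      _ ≤ dimH (Set.univ : Set E) := dimH_mono (Set.subset_univ _)
      _ = Module.finrank ℝ E := Real.dimH_univ_eq_finrank E
  -- The Lindelöf property gives a countable subcover by chart domains, and the Hausdorff dimension
  -- of a countable union is the supremum.
  obtain ⟨T, hT, hTs, hcov⟩ := hL.elim_nhds_subcover (fun x ↦ (chartAt H x).source)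
    fun x _ ↦ chart_source_mem_nhds H x
  have hle : dimH (d '' (f '' s ∩ d.source)) ≤ Module.finrank ℝ E := by
    have hsub : d '' (f '' s ∩ d.source) ⊆
        ⋃ x ∈ T, d '' (f '' (s ∩ (chartAt H x).source) ∩ d.source) := by
      rintro _ ⟨_, ⟨⟨a, ha, rfl⟩, hfa⟩, rfl⟩
      obtain ⟨x, hxT, hax⟩ := Set.mem_iUnion₂.1 (hcov ha)
      exact Set.mem_iUnion₂.2 ⟨x, hxT, _, ⟨⟨a, ⟨ha, hax⟩, rfl⟩, hfa⟩, rfl⟩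
    refine (dimH_mono hsub).trans ?_
    rw [dimH_bUnion hT]
    exact iSup₂_le fun x hx ↦ key x (hTs x hx)
  have hint : (interior (d '' (f '' s ∩ d.source))).Nonempty := by
    refine ⟨d y, mem_interior_iff_mem_nhds.2 ?_⟩
    exact extChartAt_image_nhds_mem_nhds_of_boundaryless
      (Filter.inter_mem hy (extChartAt_source_mem_nhds y))
  rw [Real.dimH_of_nonempty_interior hint] at hle
  exact_mod_cast hle

/-! ### Immersivity of equivariant injections -/

open Topology in
/-- A curve in a manifold with vanishing velocity is locally constant. -/
theorem eventually_eq_of_hasMFDerivAt_zero {F G B : Type*} [NormedAddCommGroup F] [NormedSpace ℝ F]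
    [TopologicalSpace G] {J : ModelWithCorners ℝ F G}
    [TopologicalSpace B] [ChartedSpace G B] [IsManifold J 1 B] {c : ℝ → B} {t₀ : ℝ}
    (hc : ∀ᶠ t in 𝓝 t₀, HasMFDerivAt 𝓘(ℝ, ℝ) J c t 0) : ∀ᶠ t in 𝓝 t₀, c t = c t₀ := by
  have hsrc : ∀ᶠ t in 𝓝 t₀, c t ∈ (chartAt G (c t₀)).source :=
    hc.self_of_nhds.continuousAt (chart_source_mem_nhds G (c t₀))
  obtain ⟨ε, hε, hball⟩ := Metric.eventually_nhds_iff_ball.1 (hc.and hsrc)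
  let d := extChartAt J (c t₀)
  have hd (t : ℝ) (ht : t ∈ Metric.ball t₀ ε) : HasFDerivAt (d ∘ c) (0 : ℝ →L[ℝ] F) t := by
    have h1 : MDifferentiableAt J 𝓘(ℝ, F) d (c t) := mdifferentiableAt_extChartAt (hball t ht).2
    have h2 := h1.hasMFDerivAt.comp t (hball t ht).1
    have h3 : HasMFDerivAt 𝓘(ℝ, ℝ) 𝓘(ℝ, F) (d ∘ c) t (0 : ℝ →L[ℝ] F) := by
      have h0 : (mfderiv J 𝓘(ℝ, F) d (c t)).comp
          (0 : TangentSpace 𝓘(ℝ, ℝ) t →L[ℝ] TangentSpace J (c t)) = 0 := by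
        ext; simp
      rw [h0] at h2
      exact h2
    exact hasMFDerivAt_iff_hasFDerivAt.1 h3
  refine Metric.eventually_nhds_iff_ball.2 ⟨ε, hε, fun t ht ↦ ?_⟩
  have hconst : (d ∘ c) t = (d ∘ c) t₀ :=
    Metric.isOpen_ball.is_const_of_fderiv_eq_zero (convex_ball t₀ ε).isPreconnected
      (fun t ht ↦ (hd t ht).differentiableAt.differentiableWithinAt)
      (fun t ht ↦ (hd t ht).fderiv) ht (Metric.mem_ball_self hε)
  exact d.injOn (by simpa [d] using (hball t ht).2) (by simp [d]) hconst

open Topology in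
/-- An injective map from a Lie group which intertwines left translations with differentiable
self-maps of the target is immersive at the identity. -/
theorem injective_mfderiv_one_of_equivariant {E H O F G B : Type*}
    [NormedAddCommGroup E] [NormedSpace ℝ E] [CompleteSpace E]
    [TopologicalSpace H] {I : ModelWithCorners ℝ E H} [I.Boundaryless]
    [TopologicalSpace O] [ChartedSpace H O] [Group O] [LieGroup I ∞ O]
    [NormedAddCommGroup F] [NormedSpace ℝ F] [TopologicalSpace G] {J : ModelWithCorners ℝ F G}
    [TopologicalSpace B] [ChartedSpace G B] [IsManifold J 1 B]
    {θ : O → B} (hθ : MDifferentiable I J θ) (hinj : Function.Injective θ)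
    {ρ : O → B → B} (hρ : ∀ a, MDifferentiable J J (ρ a))
    (heq : ∀ a b, θ (a * b) = ρ a (θ b)) :
    Function.Injective (mfderiv I J θ 1) := by
  rw [injective_iff_map_eq_zero]
  intro v hv
  have : LieGroup I (minSmoothness ℝ 3) O := .of_le (n := ∞) (by simpa using ENat.LEInfty.out)
  have : IsManifold I 1 O := .of_le (n := ∞) (by simp)
  have hX : ContMDiffAt I I.tangent 1
      (fun g : O ↦ (⟨g, mulInvariantVectorField v g⟩ : TangentBundle I O)) 1 :=
    (contMDiffAt_mulInvariantVectorField v).of_le (by simp)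
  obtain ⟨γ, hγ0, hγ⟩ := exists_isMIntegralCurveAt_of_contMDiffAt_boundaryless 0 hX
  -- Equivariance carries the kernel vector at `1` to the whole left-invariant field, so `θ` is
  -- constant along the integral curve `γ`.
  have hker (g : O) : mfderiv I J θ g (mulInvariantVectorField v g) = 0 := by
    have hl : MDifferentiable I I (g * ·) :=
      (contMDiff_mul_left (n := ∞)).mdifferentiable (by simp)
    have h1 : mfderiv I J (θ ∘ (g * ·)) 1 v = mfderiv I J θ (g * 1) (mfderiv I I (g * ·) 1 v) := by
      rw [mfderiv_comp 1 (hθ _) (hl _)]; rfl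
    have h2 : mfderiv I J (ρ g ∘ θ) 1 v = 0 := by
      rw [mfderiv_comp 1 (hρ g _) (hθ _)]
      exact (congrArg (mfderiv J J (ρ g) (θ 1)) hv).trans (map_zero (mfderiv J J (ρ g) (θ 1)))
    have h3 : θ ∘ (g * ·) = ρ g ∘ θ := funext (heq g)
    rw [h3, h2] at h1
    rw [mul_one] at h1
    exact h1.symm
  have hconst : ∀ᶠ t in 𝓝 (0 : ℝ), (θ ∘ γ) t = (θ ∘ γ) 0 := by
    refine eventually_eq_of_hasMFDerivAt_zero (J := J) (hγ.mono fun t ht ↦ ?_)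
    have h := (hθ (γ t)).hasMFDerivAt.comp t ht
    have aux (L : TangentSpace 𝓘(ℝ, ℝ) t →L[ℝ] TangentSpace J ((θ ∘ γ) t)) (hL : L = 0)
        (h : HasMFDerivAt 𝓘(ℝ, ℝ) J (θ ∘ γ) t L) : HasMFDerivAt 𝓘(ℝ, ℝ) J (θ ∘ γ) t 0 := hL ▸ h
    refine aux _ (ContinuousLinearMap.ext fun r ↦ ?_) h
    exact ((mfderiv I J θ (γ t)).map_smul _ _).trans
      ((congrArg _ (hker (γ t))).trans (smul_zero _))
  -- Injectivity of `θ` now makes `γ` itself constant, so its velocity `v` at time 0 vanishes.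
  have hγc : γ =ᶠ[𝓝 0] fun _ ↦ (1 : O) := hconst.mono fun t ht ↦ by
    rw [← hγ0]; exact hinj ht
  have hd := hγ.self_of_nhds
  have hd0 : HasMFDerivAt 𝓘(ℝ, ℝ) I γ 0 0 :=
    (hasMFDerivAt_const (1 : O) (0 : ℝ)).congr_of_eventuallyEq hγc
  have := hasMFDerivAt_unique hd hd0
  have h1 : (1 : ℝ) • mulInvariantVectorField v (γ 0) = 0 := DFunLike.congr_fun this (1 : ℝ)
  rw [one_smul, hγ0] at h1
  have aux (f : O → O) (hf : f = id) (h : mfderiv I I f 1 v = 0) : v = 0 := by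
    subst hf; simpa using h
  exact aux _ (funext one_mul) h1

/-! ### Transport of a manifold structure along a homeomorphism -/

/-- The charted space structure on `X` pulled back along a homeomorphism `X ≃ₜ M`. -/
abbrev Homeomorph.pullbackChartedSpace {X M : Type*} (H : Type*) [TopologicalSpace X]
    [TopologicalSpace M]
    [TopologicalSpace H] [ChartedSpace H M] (h : X ≃ₜ M) : ChartedSpace H X where
  atlas := h.transOpenPartialHomeomorph '' atlas H M
  chartAt x := h.transOpenPartialHomeomorph (chartAt H (h x))
  mem_chart_source x := by simp
  chart_mem_atlas x := ⟨_, chart_mem_atlas H (h x), rfl⟩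

section

variable {X M E H : Type*} [TopologicalSpace X]
  [TopologicalSpace M] [TopologicalSpace H] [ChartedSpace H M]
  [NormedAddCommGroup E] [NormedSpace ℝ E] {I : ModelWithCorners ℝ E H} {n : WithTop ℕ∞}

theorem Homeomorph.isManifold_pullback [IsManifold I n M] (h : X ≃ₜ M) :
    @IsManifold _ _ _ _ _ _ _ I n X _ (h.pullbackChartedSpace H) := by
  let := h.pullbackChartedSpace H
  have : HasGroupoid X (contDiffGroupoid n I) := by
    refine ⟨?_⟩
    rintro _ _ ⟨c, hc, rfl⟩ ⟨c', hc', rfl⟩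
    -- The homeomorphism cancels: transition maps upstairs are those of `M`.
    have : (h.transOpenPartialHomeomorph c).symm.trans (h.transOpenPartialHomeomorph c') =
        c.symm.trans c' := by
      ext x <;> simp
    rw [this]
    exact HasGroupoid.compatible hc hc'
  exact IsManifold.mk' I n X

/-- In the pulled-back charts `h` is the identity: near `x` it is the chart at `x` followed by the
inverse of the chart at `h x`. -/
theorem Homeomorph.contMDiff_pullback [IsManifold I n M] (h : X ≃ₜ M) :
    letI := h.pullbackChartedSpace H
    ContMDiff I I n h := by
  let := h.pullbackChartedSpace H
  have : IsManifold I n X := h.isManifold_pullback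
  intro x
  have h1 : ContMDiffAt I I n ((chartAt H (h x)).symm ∘ chartAt H x) x :=
    (contMDiffOn_chart_symm.contMDiffAt (chart_target_mem_nhds H (h x))).comp x
      (contMDiffOn_chart.contMDiffAt (chart_source_mem_nhds H x))
  refine h1.congr_of_eventuallyEq ?_
  filter_upwards [chart_source_mem_nhds H x] with y hy
  exact ((chartAt H (h x)).left_inv hy).symm

theorem Homeomorph.contMDiff_pullback_symm [IsManifold I n M] (h : X ≃ₜ M) :
    letI := h.pullbackChartedSpace H
    ContMDiff I I n h.symm := by
  let := h.pullbackChartedSpace H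
  have : IsManifold I n X := h.isManifold_pullback
  intro y
  obtain ⟨x, rfl⟩ := h.surjective y
  have h1 : ContMDiffAt I I n ((chartAt H x).symm ∘ chartAt H (h x)) (h x) :=
    (contMDiffOn_chart_symm.contMDiffAt (chart_target_mem_nhds H x)).comp (h x)
      (contMDiffOn_chart.contMDiffAt (chart_source_mem_nhds H (h x)))
  refine h1.congr_of_eventuallyEq ?_
  filter_upwards [chart_source_mem_nhds H (h x)] with y hy
  exact (congrArg h.symm ((chartAt H (h x)).left_inv hy)).symm

/-- The diffeomorphism underlying a homeomorphism along which a manifold structure is pulled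
back. -/
def Homeomorph.pullbackDiffeomorph (I : ModelWithCorners ℝ E H) (n : WithTop ℕ∞) [IsManifold I n M]
    (h : X ≃ₜ M) :
    letI := h.pullbackChartedSpace H
    Diffeomorph I I X M n :=
  letI := h.pullbackChartedSpace H
  { h.toEquiv with
    contMDiff_toFun := h.contMDiff_pullback
    contMDiff_invFun := h.contMDiff_pullback_symm }

end

/-! ### Local triviality of free s-spaces -/

namespace SSpace

variable {n m k : ℕ}
  {M : Type*} [TopologicalSpace M]
  [ChartedSpace (EuclideanSpace ℝ (Fin n)) M] [IsManifold (𝓡 n) ∞ M]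
  {N : Type*} [TopologicalSpace N]
  [ChartedSpace (EuclideanSpace ℝ (Fin m)) N] [IsManifold (𝓡 m) ∞ N]
  {O : Type*} [TopologicalSpace O]
  [ChartedSpace (EuclideanSpace ℝ (Fin k)) O] [Group O] [LieGroup (𝓡 k) ∞ O]
  (S : SSpace n m k M N O)

theorem contMDiff_proj : ContMDiff (𝓡 m) (𝓡 n) ∞ S.proj := S.isSmoothSubmersion_proj.contMDiff

theorem contMDiff_act_right (a : O) : ContMDiff (𝓡 m) (𝓡 m) ∞ fun z ↦ S.act z a :=
  S.contMDiff_act.comp (contMDiff_id.prodMk contMDiff_const)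

theorem contMDiff_act_left (z : N) : ContMDiff (𝓡 k) (𝓡 m) ∞ fun a ↦ S.act z a :=
  S.contMDiff_act.comp (contMDiff_const.prodMk contMDiff_id)

theorem act_inv_act (z : N) (a : O) : S.act (S.act z a) a⁻¹ = z := by
  rw [← S.act_mul, mul_inv_cancel, S.act_one]

theorem act_act_inv (z : N) (a : O) : S.act (S.act z a⁻¹) a = z := by
  rw [← S.act_mul, inv_mul_cancel, S.act_one]

theorem act_injective (hfree : ∀ (z : N) (a : O), S.act z a = z → a = 1) (z : N) :
    Function.Injective (S.act z) := by
  intro a b hab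
  have : S.act z (a * b⁻¹) = z := by rw [S.act_mul, hab, S.act_inv_act]
  exact mul_inv_eq_one.1 (hfree _ _ this)

theorem proj_eq_iff (z w : N) : S.proj z = S.proj w ↔ ∃ a : O, S.act z a = w :=
  ⟨S.transitive z w, by rintro ⟨a, rfl⟩; exact (S.proj_act z a).symm⟩

theorem exists_section (z : N) : ∃ (g : M → N) (t : Set M), IsOpen t ∧ S.proj z ∈ t ∧
    ContMDiffOn (𝓡 n) (𝓡 m) ∞ g t ∧ g (S.proj z) = z ∧ ∀ y ∈ t, S.proj (g y) = y := by
  obtain ⟨g, t, ht, hzt, hg, hgz, -, hgs⟩ :=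
    (S.contMDiff_proj.contMDiffOn (s := Set.univ)).exists_local_section isOpen_univ
      (Set.mem_univ z) (S.isSmoothSubmersion_proj.surjective_mfderiv z)
  exact ⟨g, t, ht, hzt, hg, hgz, hgs⟩

-- A section through `z` is continuous, so it maps all points near `ψ(z)` into a given neighbourhood
-- of `z`.
open Topology in
theorem isOpenMap_proj : IsOpenMap S.proj := by
  refine IsOpenMap.of_nhds_le fun z ↦ ?_
  intro V hV
  obtain ⟨g, t, ht, hzt, hg, hgz, hgs⟩ := S.exists_section z
  have hc : ContinuousAt g (S.proj z) := (hg.contMDiffAt (ht.mem_nhds hzt)).continuousAt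
  have : ∀ᶠ y in 𝓝 (S.proj z), g y ∈ S.proj ⁻¹' V := hc (by rwa [hgz])
  filter_upwards [this, ht.mem_nhds hzt] with y hy hyt
  simpa [hgs y hyt] using hy

theorem isQuotientMap_proj : Topology.IsQuotientMap S.proj :=
  S.isOpenMap_proj.isQuotientMap S.contMDiff_proj.continuous S.isSmoothSubmersion_proj.surjective

/-- The inverse turns the right action into a left one, `z.(ab)⁻¹ = (z.b⁻¹).a⁻¹`, matching left
translations on `O`. -/
theorem injective_mfderiv_orbit (hfree : ∀ (z : N) (a : O), S.act z a = z → a = 1) (z : N) :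
    Function.Injective (mfderiv (𝓡 k) (𝓡 m) (fun a : O ↦ S.act z a⁻¹) 1) := by
  have : IsManifold (𝓡 m) 1 N := .of_le (n := ∞) (by simp)
  exact injective_mfderiv_one_of_equivariant (ρ := fun a w ↦ S.act w a⁻¹)
    (((S.contMDiff_act_left z).comp (contMDiff_inv (𝓡 k) ∞)).mdifferentiable (by simp))
    ((S.act_injective hfree z).comp inv_injective)
    (fun a ↦ (S.contMDiff_act_right a⁻¹).mdifferentiable (by simp))
    (fun a b ↦ by rw [mul_inv_rev, S.act_mul])

/-- Transitivity on the fibres of an action of a second countable Lie group bounds the dimension of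
the total space. -/
theorem dim_le [SecondCountableTopology O] (S : SSpace n m k M N O) (z : N) : m ≤ n + k := by
  obtain ⟨g, t, ht, hzt, hg, hgz, hgs⟩ := S.exists_section z
  -- Replacing `t` by a chart image makes the source second countable, hence Lindelöf, although `M`
  -- need not be.
  let c := chartAt (EuclideanSpace ℝ (Fin n)) (S.proj z)
  let s : Set (EuclideanSpace ℝ (Fin n) × O) := (c.target ∩ c.symm ⁻¹' t) ×ˢ Set.univ
  have hs : IsOpen s := (c.isOpen_inter_preimage_symm ht).prod isOpen_univ
  have : SecondCountableTopology (EuclideanSpace ℝ (Fin n) × O) := inferInstance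
  have : IsManifold (𝓡 k) 1 O := .of_le (n := ∞) (by simp)
  have : IsManifold (𝓡 m) 1 N := .of_le (n := ∞) (by simp)
  have hf : ContMDiffOn ((𝓡 n).prod (𝓡 k)) (𝓡 m) ∞
      (fun q : EuclideanSpace ℝ (Fin n) × O ↦ S.act (g (c.symm q.1)) q.2) s := by
    have h1 : ContMDiffOn (𝓡 n) (𝓡 m) ∞ (g ∘ c.symm) (c.target ∩ c.symm ⁻¹' t) :=
      hg.comp ((contMDiffOn_chart_symm (n := ∞)).mono Set.inter_subset_left) fun y hy ↦ hy.2
    exact S.contMDiff_act.comp_contMDiffOn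
      ((h1.comp contMDiff_fst.contMDiffOn fun q hq ↦ hq.1).prodMk contMDiff_snd.contMDiffOn)
  have hle := (hf.of_le (m := 1) (by simp)).finrank_le_of_image_mem_nhds hs
    (HereditarilyLindelofSpace.isLindelof s) (y := z) (by
      have hV : IsOpen (S.proj ⁻¹' (t ∩ c.source)) :=
        (ht.inter c.open_source).preimage S.contMDiff_proj.continuous
      refine Filter.mem_of_superset (hV.mem_nhds ⟨hzt, by simp [c]⟩) fun w hw ↦ ?_
      obtain ⟨a, ha⟩ := S.transitive (g (S.proj w)) w (hgs _ hw.1)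
      refine ⟨(c (S.proj w), a), ⟨⟨c.map_source hw.2, ?_⟩, trivial⟩, ?_⟩
      · simpa [c.left_inv hw.2] using hw.1
      · simpa [c.left_inv hw.2] using ha)
  simpa using hle

-- The differential is injective, and `dim_le` forces equal dimensions.
variable {S} in
theorem surjective_mfderiv_trivialization [SecondCountableTopology O]
    (hfree : ∀ (z : N) (a : O), S.act z a = z → a = 1) {g : M → N} {t : Set M} (ht : IsOpen t)
    (hg : ContMDiffOn (𝓡 n) (𝓡 m) ∞ g t) (hgs : ∀ y ∈ t, S.proj (g y) = y)
    {x : M} (hx : x ∈ t) :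
    Function.Surjective (mfderiv ((𝓡 n).prod (𝓡 k)) (𝓡 m)
      (fun q : M × O ↦ S.act (g q.1) q.2⁻¹) (x, 1)) := by
  set F := fun q : M × O ↦ S.act (g q.1) q.2⁻¹ with hFdef
  have hgx : ContMDiffAt (𝓡 n) (𝓡 m) ∞ g x := hg.contMDiffAt (ht.mem_nhds hx)
  have hF : MDifferentiableAt ((𝓡 n).prod (𝓡 k)) (𝓡 m) F (x, 1) := by
    refine ContMDiffAt.mdifferentiableAt (n := ∞) ?_ (by simp)
    refine S.contMDiff_act.contMDiffAt.comp (x, (1 : O)) (ContMDiffAt.prodMk ?_ ?_)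
    · exact ContMDiffAt.comp (x, (1 : O)) (g := g) hgx contMDiffAt_fst
    · exact ((contMDiff_inv (𝓡 k) ∞).comp contMDiff_snd).contMDiffAt
  have hinj : Function.Injective (mfderiv ((𝓡 n).prod (𝓡 k)) (𝓡 m) F (x, 1)) := by
    rw [injective_iff_map_eq_zero]
    rintro ⟨v, w⟩ hvw
    have hproj : MDifferentiableAt (𝓡 m) (𝓡 n) S.proj (F (x, 1)) :=
      S.contMDiff_proj.mdifferentiable (by simp) _
    have hv : v = 0 := by
      -- Near `(x, 1)`, `ψ ∘ F` is the first projection, so a kernel vector has no component along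
      -- `M`.
      have h1 : (S.proj ∘ F) =ᶠ[nhds (x, 1)] Prod.fst := by
        filter_upwards [(ht.prod isOpen_univ).mem_nhds (show (x, (1 : O)) ∈ t ×ˢ Set.univ from
          ⟨hx, trivial⟩)] with q hq
        simp [hFdef, S.proj_act, hgs _ hq.1]
      have h2 : HasMFDerivAt ((𝓡 n).prod (𝓡 k)) (𝓡 n) (S.proj ∘ F) (x, (1 : O))
          (ContinuousLinearMap.fst ℝ (EuclideanSpace ℝ (Fin n)) (EuclideanSpace ℝ (Fin k))) :=
        (hasMFDerivAt_fst (x, (1 : O))).congr_of_eventuallyEq h1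
      have h3 := hasMFDerivAt_unique h2 (hproj.hasMFDerivAt.comp _ hF.hasMFDerivAt)
      exact (DFunLike.congr_fun h3 (v, w)).trans
        ((congrArg (mfderiv (𝓡 m) (𝓡 n) S.proj (F (x, 1))) hvw).trans (map_zero _))
    subst hv
    have hw : w = 0 := by
      -- On the slice `{x} × O` the map `F` is the orbit map of `g x`, which is immersive at `1`.
      have hi : HasMFDerivAt (𝓡 k) ((𝓡 n).prod (𝓡 k)) (fun a : O ↦ (x, a)) 1
          (ContinuousLinearMap.inr ℝ (EuclideanSpace ℝ (Fin n)) (EuclideanSpace ℝ (Fin k))) := by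
        exact (hasMFDerivAt_const x (1 : O)).prodMk (hasMFDerivAt_id (1 : O))
      have h2 := (hF.hasMFDerivAt.comp 1 hi).mfderiv
      apply (injective_iff_map_eq_zero _).1 (S.injective_mfderiv_orbit hfree (g x))
      exact (DFunLike.congr_fun h2 w).trans hvw
    subst hw
    rfl
  have hle := S.dim_le (g x)
  let D : EuclideanSpace ℝ (Fin n) × EuclideanSpace ℝ (Fin k) →L[ℝ] EuclideanSpace ℝ (Fin m) :=
    mfderiv ((𝓡 n).prod (𝓡 k)) (𝓡 m) F (x, 1)
  have hinj' : Function.Injective D.toLinearMap := hinj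
  have hge := LinearMap.finrank_le_finrank_of_injective hinj'
  exact (LinearMap.injective_iff_surjective_of_finrank_eq_finrank
    (le_antisymm hge (by simpa using hle))).1 hinj'

variable {S} in
/-- The coordinate `φ` of a local trivialization determined by a local section is smooth. -/
theorem contMDiffOn_fiberCoordinate [SecondCountableTopology O]
    (hfree : ∀ (z : N) (a : O), S.act z a = z → a = 1) {g : M → N} {t : Set M} (ht : IsOpen t)
    (hg : ContMDiffOn (𝓡 n) (𝓡 m) ∞ g t) (hgs : ∀ y ∈ t, S.proj (g y) = y)
    {φ : N → O} (hφ : ∀ w, S.proj w ∈ t → S.act (g (S.proj w)) (φ w) = w) :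
    ContMDiffOn (𝓡 m) (𝓡 k) ∞ φ (S.proj ⁻¹' t) := by
  have huniq (w : N) (hw : S.proj w ∈ t) (x : M) (hx : x ∈ t) (a : O) (h : S.act (g x) a = w) :
      φ w = a := by
    have hxw : S.proj w = x := by rw [← h, S.proj_act, hgs x hx]
    apply S.act_injective hfree (g x)
    rw [h, ← hxw, hφ w hw]
  have hopen : IsOpen (S.proj ⁻¹' t) := ht.preimage S.contMDiff_proj.continuous
  -- smoothness along the section
  have hsec (x : M) (hx : x ∈ t) : ContMDiffAt (𝓡 m) (𝓡 k) ∞ φ (g x) := by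
    have hF : ContMDiffOn ((𝓡 n).prod (𝓡 k)) (𝓡 m) ∞ (fun q : M × O ↦ S.act (g q.1) q.2⁻¹)
        (t ×ˢ Set.univ) :=
      S.contMDiff_act.comp_contMDiffOn ((hg.comp contMDiff_fst.contMDiffOn fun q hq ↦ hq.1).prodMk
        ((contMDiff_inv (𝓡 k) ∞).comp contMDiff_snd).contMDiffOn)
    -- By freeness (`huniq`), the second component of any local section of `F`, inverted, must agree
    -- with `φ`.
    obtain ⟨G, u, hu, hxu, hG, -, hGm, hGs⟩ := hF.exists_local_section (ht.prod isOpen_univ)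
      (x := (x, (1 : O))) ⟨hx, trivial⟩ (surjective_mfderiv_trivialization hfree ht hg hgs hx)
    simp only [inv_one, S.act_one] at hxu
    have hG2 : ContMDiffAt (𝓡 m) (𝓡 k) ∞ (fun w ↦ (G w).2⁻¹) (g x) :=
      ((contMDiff_inv (𝓡 k) ∞).comp contMDiff_snd).contMDiffAt.comp (g x)
        (hG.contMDiffAt (hu.mem_nhds hxu))
    refine hG2.congr_of_eventuallyEq ?_
    filter_upwards [hu.mem_nhds hxu] with w hw
    have hwt := (hGm hw).1
    refine huniq w ?_ _ hwt _ (hGs w hw)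
    rw [← hGs w hw, S.proj_act, hgs _ hwt]
    exact hwt
  intro w hw
  refine ContMDiffAt.contMDiffWithinAt ?_
  have hwa : S.act w (φ w)⁻¹ = g (S.proj w) := by
    have h := S.act_inv_act (g (S.proj w)) (φ w)
    rwa [hφ w hw] at h
  -- Translating by `φ(w)⁻¹` moves `w` onto the section, and `φ(w') = φ(w'.φ(w)⁻¹) φ(w)` carries
  -- smoothness back to `w`.
  have h1 : ContMDiffAt (𝓡 m) (𝓡 k) ∞ (fun w' ↦ φ (S.act w' (φ w)⁻¹) * φ w) w := by
    refine ContMDiffAt.mul (I := 𝓡 k) ?_ contMDiffAt_const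
    refine ContMDiffAt.comp w (g := φ) ?_ (S.contMDiff_act_right _).contMDiffAt
    rw [hwa]
    exact hsec _ hw
  refine h1.congr_of_eventuallyEq ?_
  filter_upwards [hopen.mem_nhds hw] with w' hw'
  refine huniq w' hw' _ hw' _ ?_
  have h2 := hφ (S.act w' (φ w)⁻¹) (by rw [S.proj_act]; exact hw')
  rw [S.proj_act] at h2
  rw [S.act_mul, h2, S.act_act_inv]

theorem exists_localTrivialization [SecondCountableTopology O]
    (hfree : ∀ (z : N) (a : O), S.act z a = z → a = 1) (p : M) :
    ∃ U : Set M, IsOpen U ∧ p ∈ U ∧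
      ∃ τ : PartialDiffeomorph (𝓡 m) ((𝓡 n).prod (𝓡 k)) N (M × O) ∞,
        τ.source = S.proj ⁻¹' U ∧ τ.target = U ×ˢ Set.univ ∧
        (∀ z : N, S.proj z ∈ U → (τ.toPartialEquiv z).1 = S.proj z) ∧
        (∀ (z : N) (a : O), S.proj z ∈ U →
          (τ.toPartialEquiv (S.act z a)).2 = (τ.toPartialEquiv z).2 * a) := by
  obtain ⟨z, rfl⟩ := S.isSmoothSubmersion_proj.surjective p
  obtain ⟨g, t, ht, hzt, hg, -, hgs⟩ := S.exists_section z
  have hex (w : N) : ∃ a : O, S.proj w ∈ t → S.act (g (S.proj w)) a = w := by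
    by_cases hw : S.proj w ∈ t
    · obtain ⟨a, ha⟩ := S.transitive (g (S.proj w)) w (hgs _ hw)
      exact ⟨a, fun _ ↦ ha⟩
    -- Outside `ψ⁻¹(t)` the value of `φ` is irrelevant.
    · exact ⟨1, fun h ↦ absurd h hw⟩
  choose φ hφ using hex
  refine ⟨t, ht, hzt,
    { toFun := fun w ↦ (S.proj w, φ w)
      invFun := fun q ↦ S.act (g q.1) q.2
      source := S.proj ⁻¹' t
      target := t ×ˢ Set.univ
      map_source' := fun w hw ↦ ⟨hw, trivial⟩
      map_target' := fun q hq ↦ ?_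
      left_inv' := fun w hw ↦ hφ w hw
      right_inv' := fun q hq ↦ ?_
      open_source := ht.preimage S.contMDiff_proj.continuous
      open_target := ht.prod isOpen_univ
      contMDiffOn_toFun := S.contMDiff_proj.contMDiffOn.prodMk
        (contMDiffOn_fiberCoordinate hfree ht hg hgs hφ)
      contMDiffOn_invFun := S.contMDiff_act.comp_contMDiffOn
        ((hg.comp contMDiff_fst.contMDiffOn fun q hq ↦ hq.1).prodMk
          contMDiff_snd.contMDiffOn) },
    rfl, rfl, fun _ _ ↦ rfl, fun w a hw ↦ ?_⟩
  · simp only [Set.mem_preimage, S.proj_act, hgs _ hq.1]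
    exact hq.1
  · have hq1 : S.proj (S.act (g q.1) q.2) = q.1 := by rw [S.proj_act, hgs _ hq.1]
    refine Prod.ext hq1 (S.act_injective hfree (g q.1) ?_)
    have := hφ (S.act (g q.1) q.2) (by rw [hq1]; exact hq.1)
    rwa [hq1] at this
  · refine S.act_injective hfree (g (S.proj w)) ?_
    have := hφ (S.act w a) (by rwa [S.proj_act])
    rw [S.proj_act] at this
    exact this.trans (by rw [S.act_mul, hφ w hw])

theorem isPrincipalFiberBundle [SecondCountableTopology O]
    (hfree : ∀ (z : N) (a : O), S.act z a = z → a = 1) :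
    IsPrincipalFiberBundle n m k S.proj S.act where
  act_one := S.act_one
  act_mul := S.act_mul
  contMDiff_act := S.contMDiff_act
  free := hfree
  contMDiff_proj := S.contMDiff_proj
  isQuotientMap_proj := S.isQuotientMap_proj
  proj_eq_iff := S.proj_eq_iff
  locallyTrivial := S.exists_localTrivialization hfree

/-! ### The orbit space -/

/-- The orbit space is homeomorphic to the base. -/
noncomputable def orbitSpaceHomeomorph : Quotient S.orbitSetoid ≃ₜ M :=
  (Equiv.ofBijective
    (Quotient.lift S.proj fun z w h ↦ (S.proj_eq_iff z w).2 h : Quotient S.orbitSetoid → M)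
    ⟨by
      rintro ⟨z⟩ ⟨w⟩ h
      exact Quotient.sound ((S.proj_eq_iff z w).1 h),
    fun p ↦ by
      obtain ⟨z, rfl⟩ := S.isSmoothSubmersion_proj.surjective p
      exact ⟨Quotient.mk _ z, rfl⟩⟩).toHomeomorphOfContinuousOpen
    (S.contMDiff_proj.continuous.quotient_lift _)
    (fun V hV ↦ by
      convert! S.isOpenMap_proj _ (hV.preimage continuous_quotient_mk') using 1
      ext p
      constructor
      · rintro ⟨⟨z⟩, hz, rfl⟩
        exact ⟨z, hz, rfl⟩
      · rintro ⟨z, hz, rfl⟩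
        exact ⟨Quotient.mk _ z, hz, rfl⟩)

theorem orbitSpaceHomeomorph_mk (z : N) :
    S.orbitSpaceHomeomorph (Quotient.mk S.orbitSetoid z) = S.proj z := rfl

end SSpace

theorem theorem6 {n m k : ℕ}
    {M : Type*} [TopologicalSpace M] [T2Space M]
    [ChartedSpace (EuclideanSpace ℝ (Fin n)) M] [IsManifold (𝓡 n) ∞ M]
    {N : Type*} [TopologicalSpace N] [T2Space N]
    [ChartedSpace (EuclideanSpace ℝ (Fin m)) N] [IsManifold (𝓡 m) ∞ N]
    {O : Type*} [TopologicalSpace O] [T2Space O] [SecondCountableTopology O]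
    [ChartedSpace (EuclideanSpace ℝ (Fin k)) O] [Group O] [LieGroup (𝓡 k) ∞ O]
    (S : SSpace n m k M N O)
    (hfree : ∀ (z : N) (a : O), S.act z a = z → a = 1) :
    IsPrincipalFiberBundle n m k S.proj S.act ∧
      ∃ _ : ChartedSpace (EuclideanSpace ℝ (Fin n)) (Quotient S.orbitSetoid),
        IsManifold (𝓡 n) ∞ (Quotient S.orbitSetoid) ∧
        IsSmoothSubmersion (m := m) (n := n)
          (fun z : N => (Quotient.mk S.orbitSetoid z : Quotient S.orbitSetoid)) ∧
        ∃ Φ : Diffeomorph (𝓡 n) (𝓡 n) (Quotient S.orbitSetoid) M ∞,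
          ∀ z : N, Φ (Quotient.mk S.orbitSetoid z) = S.proj z := by
  let := S.orbitSpaceHomeomorph.pullbackChartedSpace (EuclideanSpace ℝ (Fin n))
  let Φ : Diffeomorph (𝓡 n) (𝓡 n) (Quotient S.orbitSetoid) M ∞ :=
    S.orbitSpaceHomeomorph.pullbackDiffeomorph (𝓡 n) ∞
  -- With the transported structure the quotient map is `ψ` followed by a diffeomorphism, so it
  -- inherits the submersion property.
  have hπ : (fun z : N ↦ (Quotient.mk S.orbitSetoid z : Quotient S.orbitSetoid)) =
      Φ.symm ∘ S.proj := funext fun z ↦ (Φ.symm_apply_apply _).symm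
  refine ⟨S.isPrincipalFiberBundle hfree, this, S.orbitSpaceHomeomorph.isManifold_pullback,
    ⟨?_, Quotient.mk_surjective, fun z ↦ ?_⟩, Φ, S.orbitSpaceHomeomorph_mk⟩
  · rw [hπ]
    exact Φ.symm.contMDiff.comp S.contMDiff_proj
  · rw [hπ, mfderiv_comp z (Φ.symm.mdifferentiable (by simp) _)
      (S.contMDiff_proj.mdifferentiable (by simp) z)]
    exact (Φ.symm.mfderivToContinuousLinearEquiv (by simp) (S.proj z)).surjective.comp
      (S.isSmoothSubmersion_proj.surjective_mfderiv z)
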